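/- Let $d\ge 2$. For $(c,a)=(c_1,\dots,c_{d-2},a)\in\mathbb C^{d-1}$ put $c_0=0$ and $$P_{c,a}(z)=\frac1d z^d+\sum_{j=2}^{d-1}(-1)^{d-j}\sigma_{d-j}(c)\frac{z^j}{j}+a^d,$$ where $\sigma_k$ is the $k$-th elementary symmetric polynomial in $c_1,\dots,c_{d-2}$, so that $c_0,\dots,c_{d-2}$ are the critical points of $P_{c,a}$. For $0\le i\le d-2$ and integers $m>n\ge 0$ let $\mathrm{Per}_i(m,n)\subset\mathbb C^{d-1}$ be the hypersurface $\{(c,a): P_{c,a}^m(c_i)=P_{c,a}^n(c_i)\}$ (iterates of $P_{c,a}$), taken with its reduced structure. For tuples $\underline m=(m_0,\dots,m_{d-2})$ and $\underline n=(n_0,\dots,n_{d-2})$ of non-negative integers with $m_i>n_i$ for all $i$, let $\mathrm{TPCF}(\underline m,\underline n)$ be the set of points of $\bigcap_{i=0}^{d-2}\mathrm{Per}_i(m_i,n_i)$ at which the $d-1$ hypersurfaces $\mathrm{Per}_i(m_i,n_i)$ are all smooth and intersect transversely, and write $|\underline m|=m_0+\dots+m_{d-2}$. Let $(\underline m_k)_k$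 and $(\underline n_k)_k$ be two sequences of $(d-1)$-tuples of non-negative integers such that $m_{k,i}>n_{k,i}$ for all $k$ and $i$, and $m_{k,i}\to\infty$ as $k\to\infty$ for every $0\le i\le d-2$. Then for every proper closed algebraic subset $V\subsetneq\mathbb A^{d-1}_{\mathbb C}$ (not necessarily irreducible), the sets $V\cap\mathrm{TPCF}(\underline m_k,\underline n_k)$ are finite and $$\mathrm{card}\bigl(V\cap\mathrm{TPCF}(\underline m_k,\underline n_k)\bigr)=o\bigl(d^{|\underline m_k|}\bigr)\qquad (k\to\infty).$$ -/

import Mathlib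

/-! ### Smoothness and transversality of hypersurfaces in affine space -/

/-- The (Zariski) tangent space at `p` of a subset `Z` of the affine space `ℂ^σ`: the vectors
killed by the differentials at `p` of all polynomials vanishing on `Z`. Thus an algebraic set is
considered with its reduced structure. -/
noncomputable def tangentSpaceAt {σ : Type*} [Fintype σ] (Z : Set (σ → ℂ)) (p : σ → ℂ) :
    Submodule ℂ (σ → ℂ) where
  carrier := {v | ∀ f ∈ MvPolynomial.vanishingIdeal ℂ Z,
    ∑ s, MvPolynomial.eval p (MvPolynomial.pderiv s f) * v s = 0}
  zero_mem' := by
    intro f _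
    simp
  add_mem' := by
    intro v w hv hw f hf
    simp only [Pi.add_apply, mul_add, Finset.sum_add_distrib]
    rw [hv f hf, hw f hf, add_zero]
  smul_mem' := by
    intro t v hv f hf
    have h : ∑ s, MvPolynomial.eval p (MvPolynomial.pderiv s f) * (t • v) s
        = t * ∑ s, MvPolynomial.eval p (MvPolynomial.pderiv s f) * v s := by
      rw [Finset.mul_sum]
      refine Finset.sum_congr rfl fun s _ => ?_
      simp only [Pi.smul_apply, smul_eq_mul]
      ring
    rw [h, hv f hf, mul_zero]

/-- A hypersurface `H` of `ℂ^σ` (pure codimension one) is smooth at the point `p ∈ H`: its tangent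
space at `p` is a hyperplane, i.e. has the dimension of `H`. -/
def HypersurfaceSmoothAt {σ : Type*} [Fintype σ] (H : Set (σ → ℂ)) (p : σ → ℂ) : Prop :=
  p ∈ H ∧ Module.finrank ℂ (tangentSpaceAt H p) + 1 = Fintype.card σ

/-- Finitely many hypersurfaces `H i`, smooth at `p`, intersect transversely at `p`: the
intersection of their tangent hyperplanes has codimension the number of hypersurfaces. -/
def HypersurfacesTransverseAt {σ ι : Type*} [Fintype σ] [Fintype ι]
    (H : ι → Set (σ → ℂ)) (p : σ → ℂ) : Prop :=
  Module.finrank ℂ (⨅ i, tangentSpaceAt (H i) p : Submodule ℂ (σ → ℂ)) + Fintype.card ι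
    = Fintype.card σ

/-! ### The family `P_{c,a}` of degree `d` polynomials with marked critical points -/

/-- Index set of the `d - 1` coordinates `(c₁, …, c_{d-2}, a)`: the index `Sum.inl j` is that of
`c_{j+1}` and the index `Sum.inr ()` is that of `a`. -/
abbrev ParamIndex (d : ℕ) : Type := Fin (d - 2) ⊕ Unit

/-- The parameter space `𝔸^{d-1}(ℂ)`. -/
abbrev ParamSpace (d : ℕ) : Type := ParamIndex d → ℂ

/-- The part `c = (c₁, …, c_{d-2})` of a parameter `(c, a)`. -/
def paramC {d : ℕ} (x : ParamSpace d) : Fin (d - 2) → ℂ := fun j => x (Sum.inl j)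

/-- The part `a` of a parameter `(c, a)`. -/
def paramA {d : ℕ} (x : ParamSpace d) : ℂ := x (Sum.inr ())

/-- The marked critical points `c₀ = 0, c₁, …, c_{d-2}`. -/
def critPoint {d : ℕ} (x : ParamSpace d) (i : Fin (d - 1)) : ℂ :=
  if h : (i : ℕ) = 0 then 0 else paramC x ⟨(i : ℕ) - 1, by omega⟩

/-- `P_{c,a}(z) = z^d / d + ∑_{j=2}^{d-1} (-1)^{d-j} σ_{d-j}(c) z^j / j + a^d`, where `σ_k` is the
`k`-th elementary symmetric polynomial. -/
noncomputable def critPoly {d : ℕ} (x : ParamSpace d) : Polynomial ℂ :=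
  Polynomial.C (1 / (d : ℂ)) * Polynomial.X ^ d
    + ∑ j ∈ Finset.Icc 2 (d - 1),
        Polynomial.C ((-1 : ℂ) ^ (d - j)
            * MvPolynomial.eval (paramC x) (MvPolynomial.esymm (Fin (d - 2)) ℂ (d - j)) / (j : ℂ))
          * Polynomial.X ^ j
    + Polynomial.C (paramA x ^ d)

/-- The `k`-th iterate `P_{c,a}^k(c_i)` of the marked critical point `c_i`. -/
noncomputable def critOrbit {d : ℕ} (x : ParamSpace d) (i : Fin (d - 1)) (k : ℕ) : ℂ :=
  (fun z : ℂ => (critPoly x).eval z)^[k] (critPoint x i)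

/-- `Per_i(m, n) = {(c, a) : P_{c,a}^m(c_i) = P_{c,a}^n(c_i)}`. -/
def PerLocus {d : ℕ} (i : Fin (d - 1)) (m n : ℕ) : Set (ParamSpace d) :=
  {x | critOrbit x i m = critOrbit x i n}

/-- `PCF(m, n) = ⋂_i Per_i(m_i, n_i)`. -/
def PCF {d : ℕ} (m n : Fin (d - 1) → ℕ) : Set (ParamSpace d) :=
  ⋂ i, PerLocus i (m i) (n i)

/-- `TPCF(m, n)`: the points of `PCF(m, n)` at which the hypersurfaces `Per_i(m_i, n_i)` are smooth
and transverse. -/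
def TPCF {d : ℕ} (m n : Fin (d - 1) → ℕ) : Set (ParamSpace d) :=
  {x | x ∈ PCF m n ∧ (∀ i, HypersurfaceSmoothAt (PerLocus i (m i) (n i)) x) ∧
    HypersurfacesTransverseAt (fun i => PerLocus i (m i) (n i)) x}

/-- Closed algebraic subsets of `ℂ^σ` (not necessarily irreducible). -/
def IsAlgebraicSubset {σ : Type*} (V : Set (σ → ℂ)) : Prop :=
  ∃ I : Ideal (MvPolynomial σ ℂ), V = MvPolynomial.zeroLocus ℂ I

/-!
With its reduced structure, `Per_i(m, n)` is cut out by a square-free polynomial of degree at most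
`d ^ m`. The points of `TPCF(m, n)` are nondegenerate zeros of the square system formed by these
polynomials, so everything rests on a weak Bézout bound for nondegenerate zeros.

Let `p_1, …, p_N` be nondegenerate zeros of `f = (f_1, …, f_n)` and let the linear form `u` separate
them. In a relation `∑ k < N, a_k(f) u ^ k = 0` compare the terms of lowest order along the line
`p_j + t v`: since `f(p_j + t v) = t w + O(t²)` with `w` the Jacobian at `p_j` applied to `v`, the
lowest forms `α_k` satisfy `∑ k, α_k(w) u(p_j) ^ k = 0` for all `j` and all `w`, and Vandermonde
gives `α_k = 0`. Hence the products `f ^ β u ^ k` with `k < N` are linearly independent; counting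
those of bounded degree yields `N ≤ (n + 1) ^ n ∏ deg f_i`.

Now let `V ⊆ {q = 0}` with `q ≠ 0`. Every zero of `q` is a simple zero of one of finitely many
iterated partial derivatives `h` of `q`, and `h` can replace one of the equations of a nondegenerate
system while keeping it nondegenerate. The factor `d ^ m_j` of the replaced equation then turns into
a constant, so that `V` contains `O(∑ j, d ^ (|m| - m_j))` points of `TPCF(m, n)`.
-/

open MvPolynomial Filter

section Differential

variable {σ ι R : Type*} [Fintype σ] [CommSemiring R]

/-- The differential at `p` of a polynomial function `f`, as a linear form on the space of tangent
vectors. It is algebraic, so that it makes sense over any coefficient ring. -/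
noncomputable def differentialAt (f : MvPolynomial σ R) (p : σ → R) : Module.Dual R (σ → R) :=
  ∑ s, eval p (pderiv s f) • LinearMap.proj s

/-- The Jacobian map at `p` of the polynomial map with components `f i`. -/
noncomputable def jacobianAt (f : ι → MvPolynomial σ R) (p : σ → R) : (σ → R) →ₗ[R] (ι → R) :=
  LinearMap.pi fun i => differentialAt (f i) p

theorem differentialAt_apply (f : MvPolynomial σ R) (p v : σ → R) :
    differentialAt f p v = ∑ s, eval p (pderiv s f) * v s := by
  simp [differentialAt]

theorem differentialAt_single [DecidableEq σ] (f : MvPolynomial σ R) (p : σ → R) (s : σ) :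
    differentialAt f p (Pi.single s 1) = eval p (pderiv s f) := by
  simp [differentialAt_apply, Pi.single_apply]

theorem differentialAt_C (r : R) (p : σ → R) : differentialAt (C r) p = 0 := by
  simp [differentialAt]

theorem differentialAt_mul (f g : MvPolynomial σ R) (p : σ → R) :
    differentialAt (f * g) p = eval p f • differentialAt g p + eval p g • differentialAt f p := by
  simp only [differentialAt, pderiv_mul, map_add, map_mul, add_smul, Finset.sum_add_distrib,
    Finset.smul_sum, smul_smul, mul_comm (eval p g)]
  exact add_comm _ _

theorem jacobianAt_apply (f : ι → MvPolynomial σ R) (p v : σ → R) (i : ι) :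
    jacobianAt f p v i = differentialAt (f i) p v := rfl

theorem jacobianAt_update [DecidableEq ι] (f : ι → MvPolynomial σ R) (p : σ → R) (j : ι)
    (h : MvPolynomial σ R) :
    jacobianAt (Function.update f j h) p =
      LinearMap.pi (Function.update (fun i => differentialAt (f i) p) j (differentialAt h p)) :=
  congrArg LinearMap.pi <|
    funext fun i => Function.apply_update (fun _ q => differentialAt q p) f j h i

end Differential

section LeadingForms

open Polynomial (coeff_X_pow_mul')

variable {σ ι R : Type*} [CommSemiring R]

theorem aeval_mul_of_isHomogeneous {A : Type*} [CommSemiring A] [Algebra R A]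
    {φ : MvPolynomial ι R} {e : ℕ} (hφ : φ.IsHomogeneous e) (t : A) (z : ι → A) :
    aeval (fun i => t * z i) φ = t ^ e * aeval z φ := by
  simp only [aeval_def, eval₂_eq, Finset.mul_sum]
  refine Finset.sum_congr rfl fun m hm => ?_
  rw [Finset.prod_congr rfl fun i _ => mul_pow t (z i) (m i), Finset.prod_mul_distrib,
    Finset.prod_pow_eq_pow_sum, ← hφ.degree_eq_sum_deg_support hm]
  ring

theorem coeff_zero_aeval (φ : MvPolynomial ι R) (z : ι → Polynomial R) :
    (aeval z φ).coeff 0 = eval (fun i => (z i).coeff 0) φ := by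
  simpa [aeval_eq_eval, Polynomial.coeff_zero_eq_aeval_zero] using
    comp_aeval_apply (φ := (Polynomial.aeval 0 : Polynomial R →ₐ[R] R)) z φ

theorem coeff_aeval_X_mul_mul {a : MvPolynomial ι R} {e : ℕ}
    (ha : ∀ j < e, homogeneousComponent j a = 0) (z : ι → Polynomial R) (q : Polynomial R) :
    (aeval (fun i => Polynomial.X * z i) a * q).coeff e =
      eval (fun i => (z i).coeff 0) (homogeneousComponent e a) * q.coeff 0 := by
  have hcomp (j : ℕ) : aeval (fun i => Polynomial.X * z i) (homogeneousComponent j a) =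
      Polynomial.X ^ j * aeval z (homogeneousComponent j a) :=
    aeval_mul_of_isHomogeneous (homogeneousComponent_isHomogeneous j a) _ z
  conv_lhs => rw [← sum_homogeneousComponent a]
  simp only [map_sum, Finset.sum_mul, Polynomial.finsetSum_coeff, hcomp, mul_assoc,
    coeff_X_pow_mul']
  rw [Finset.sum_eq_single e]
  · simp [Polynomial.mul_coeff_zero, coeff_zero_aeval]
  · intro j _ hj
    rcases hj.lt_or_gt with hlt | hgt
    · simp [ha j hlt]
    · rw [if_neg hgt.not_ge]
  · intro he
    simp [homogeneousComponent_eq_zero e a (by simpa using he)]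

/-- The restriction of a polynomial to the parametrised line `t ↦ p + t v`. -/
noncomputable def restrictLine (p v : σ → R) : MvPolynomial σ R →ₐ[R] Polynomial R :=
  aeval fun s => Polynomial.C (p s) + Polynomial.X * Polynomial.C (v s)

theorem coeff_zero_restrictLine (p v : σ → R) (f : MvPolynomial σ R) :
    (restrictLine p v f).coeff 0 = eval p f := by
  simp [restrictLine, coeff_zero_aeval]

theorem coeff_one_restrictLine [Fintype σ] (p v : σ → R) (f : MvPolynomial σ R) :
    (restrictLine p v f).coeff 1 = differentialAt f p v := by
  classical
  induction f using MvPolynomial.induction_on with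
  | C r => simp [restrictLine, differentialAt_C]
  | add f g hf hg =>
    simp [hf, hg, differentialAt_apply, add_mul, Finset.sum_add_distrib]
  | mul_X f s hf =>
    have hX : differentialAt (X s) p v = v s := by
      simp [differentialAt_apply, pderiv_X, Pi.single_apply, apply_ite (eval p)]
    have hline : restrictLine p v (X s) = Polynomial.C (p s) + Polynomial.X * Polynomial.C (v s) :=
      aeval_X _ _
    rw [differentialAt_mul, map_mul, Polynomial.mul_coeff_one, hf, coeff_zero_restrictLine, hline]
    simp only [hX, eval_X, Polynomial.coeff_add, Polynomial.coeff_C_zero, Polynomial.coeff_C_succ,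
      Polynomial.mul_coeff_zero, Polynomial.coeff_X_mul, Polynomial.coeff_X_zero, smul_eq_mul,
      LinearMap.add_apply, LinearMap.smul_apply]
    ring

/-- To lowest order along the line `p + t v`, the map `f` is `t` times its Jacobian at `v`. -/
theorem coeff_restrictLine_aeval_mul [Fintype σ] {f : ι → MvPolynomial σ R} {p : σ → R}
    (hp : ∀ i, eval p (f i) = 0) (v : σ → R) {a : MvPolynomial ι R} {e : ℕ}
    (ha : ∀ j < e, homogeneousComponent j a = 0) (b : MvPolynomial σ R) :
    (restrictLine p v (aeval f a * b)).coeff e =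
      eval (jacobianAt f p v) (homogeneousComponent e a) * eval p b := by
  have hf (i : ι) : restrictLine p v (f i) = Polynomial.X * (restrictLine p v (f i)).divX := by
    conv_lhs => rw [← Polynomial.X_mul_divX_add (restrictLine p v (f i)),
      coeff_zero_restrictLine, hp i, map_zero, add_zero]
  have hJ : (fun i => (restrictLine p v (f i)).divX.coeff 0) = jacobianAt f p v :=
    funext fun i => coeff_one_restrictLine p v (f i)
  rw [map_mul, comp_aeval_apply, funext hf, coeff_aeval_X_mul_mul ha, hJ, coeff_zero_restrictLine]

end LeadingForms

section Independence

variable {σ ι K : Type*} [Field K] [Infinite K]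

theorem exists_totalDegree_le_one_injective_eval [Finite σ] {α : Type*} [Finite α] {p : α → σ → K}
    (hp : Function.Injective p) :
    ∃ u : MvPolynomial σ K, u.totalDegree ≤ 1 ∧ Function.Injective fun j => eval (p j) u := by
  classical
  have := Fintype.ofFinite σ
  obtain ⟨φ, hφ⟩ := Module.exists_dual_forall_apply_ne_zero (K := K)
    (fun q : {q : α × α // q.1 ≠ q.2} => p q.1.1 - p q.1.2)
    fun q => sub_ne_zero.2 (hp.ne q.2)
  have heval (x : σ → K) : eval x (∑ s, C (φ (Pi.basisFun K σ s)) * X s) = φ x := by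
    conv_rhs => rw [← (Pi.basisFun K σ).sum_repr x, map_sum]
    simp [mul_comm]
  refine ⟨∑ s, C (φ (Pi.basisFun K σ s)) * X s, totalDegree_finsetSum_le fun s _ =>
    (totalDegree_mul _ _).trans (by simp), fun i j hij => ?_⟩
  by_contra hne
  refine hφ ⟨(i, j), hne⟩ ?_
  rw [map_sub, sub_eq_zero, ← heval, ← heval]
  exact hij

variable [Fintype σ] {N : ℕ}

theorem eq_zero_of_sum_aeval_mul_pow_eq_zero {f : ι → MvPolynomial σ K} {p : Fin N → σ → K}
    (hp : ∀ j i, eval (p j) (f i) = 0) (hJ : ∀ j, Function.Surjective (jacobianAt f (p j)))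
    {u : MvPolynomial σ K} (hu : Function.Injective fun j => eval (p j) u)
    {a : Fin N → MvPolynomial ι K} (ha : ∑ k, aeval f (a k) * u ^ (k : ℕ) = 0) : a = 0 := by
  suffices hcomp : ∀ e k, homogeneousComponent e (a k) = 0 by
    ext1 k
    rw [← sum_homogeneousComponent (a k)]
    simp [hcomp]
  intro e
  induction e using Nat.strong_induction_on with
  | _ e ih =>
    have hvalue (w : ι → K) : (fun k => eval w (homogeneousComponent e (a k))) = 0 := by
      refine Matrix.eq_zero_of_forall_index_sum_mul_pow_eq_zero hu fun j => ?_
      obtain ⟨v, rfl⟩ := hJ j w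
      have hcoeff := congrArg (fun q => (restrictLine (p j) v q).coeff e) ha
      simpa only [map_sum, Polynomial.finsetSum_coeff, map_zero, Polynomial.coeff_zero, map_pow,
        coeff_restrictLine_aeval_mul (hp j) v fun l hl => ih l hl _] using hcoeff
    exact fun k => MvPolynomial.funext fun w => by simpa using congrFun (hvalue w) k

theorem linearIndependent_aeval_monomial_mul_pow {f : ι → MvPolynomial σ K} {p : Fin N → σ → K}
    (hp : ∀ j i, eval (p j) (f i) = 0) (hJ : ∀ j, Function.Surjective (jacobianAt f (p j)))
    {u : MvPolynomial σ K} (hu : Function.Injective fun j => eval (p j) u) :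
    LinearIndependent K fun q : Σ _ : Fin N, ι →₀ ℕ =>
      aeval f (monomial q.2 (1 : K)) * u ^ (q.1 : ℕ) := by
  classical
  let Ψ : (Fin N → MvPolynomial ι K) →ₗ[K] MvPolynomial σ K :=
    ∑ k : Fin N, LinearMap.mulRight K (u ^ (k : ℕ)) ∘ₗ (aeval f).toLinearMap ∘ₗ LinearMap.proj k
  have hΨ (a) : Ψ a = ∑ k, aeval f (a k) * u ^ (k : ℕ) := by simp [Ψ]
  have hker : LinearMap.ker Ψ = ⊥ := LinearMap.ker_eq_bot'.2 fun a ha =>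
    eq_zero_of_sum_aeval_mul_pow_eq_zero hp hJ hu ((hΨ a).symm.trans ha)
  have hbasis (q : Σ _ : Fin N, ι →₀ ℕ) :
      Ψ (Pi.basis (fun _ => basisMonomials ι K) q) =
        aeval f (monomial q.2 (1 : K)) * u ^ (q.1 : ℕ) := by
    rw [hΨ, Pi.basis_apply, Finset.sum_eq_single q.1]
    · simp only [Pi.single_eq_same, coe_basisMonomials]
    · intro k _ hk
      rw [Pi.single_eq_of_ne hk, map_zero, zero_mul]
    · simp
  rw [← funext hbasis]
  exact (Pi.basis fun _ => basisMonomials ι K).linearIndependent.map' Ψ hker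

end Independence

section Bezout

variable {σ ι K : Type*} [Fintype σ] [Field K]

/-- A nondegenerate zero `p` of a polynomial system `f` with as many equations as unknowns: the
Jacobian map at `p` is invertible. -/
structure IsNondegenerateZero (f : ι → MvPolynomial σ K) (p : σ → K) : Prop where
  eval_eq_zero : ∀ i, eval p (f i) = 0
  bijective_jacobianAt : Function.Bijective (jacobianAt f p)

namespace IsNondegenerateZero

variable {f : ι → MvPolynomial σ K} {p : σ → K}

theorem card_eq [Fintype ι] (h : IsNondegenerateZero f p) :
    Fintype.card σ = Fintype.card ι := by
  simpa using (LinearEquiv.ofBijective _ h.bijective_jacobianAt).finrank_eq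

theorem totalDegree_ne_zero (h : IsNondegenerateZero f p) (i : ι) : (f i).totalDegree ≠ 0 := by
  intro h0
  obtain ⟨v, hv⟩ := h.bijective_jacobianAt.surjective 1
  have hvi := congrFun hv i
  rw [jacobianAt_apply, totalDegree_eq_zero_iff_eq_C.1 h0, differentialAt_C] at hvi
  exact zero_ne_one hvi

end IsNondegenerateZero

theorem card_le_of_linearIndependent_of_mem_restrictDegree {α : Type*} [Fintype α] {T : ℕ}
    {b : α → MvPolynomial σ K} (hb : LinearIndependent K b)
    (hT : ∀ q, b q ∈ restrictDegree σ K T) : Fintype.card α ≤ (T + 1) ^ Fintype.card σ := by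
  let exponents : {m : σ →₀ ℕ | ∀ s, m s ≤ T} ≃ (σ → Set.Iic T) :=
    (Finsupp.equivFunOnFinite.subtypeEquiv (q := fun m => ∀ s, m s ∈ Set.Iic T)
      fun _ => Iff.rfl).trans Equiv.subtypePiEquivPi
  let B : Module.Basis (σ → Set.Iic T) K (restrictDegree σ K T) :=
    (basisRestrictSupport K {m : σ →₀ ℕ | ∀ s, m s ≤ T}).reindex exponents
  have : Module.Finite K (restrictDegree σ K T) := Module.Finite.of_basis B
  have hfinrank : Module.finrank K (restrictDegree σ K T) = (T + 1) ^ Fintype.card σ := by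
    rw [Module.finrank_eq_nat_card_basis B]
    simp [Nat.card_fun]
  rw [← hfinrank]
  exact LinearIndependent.fintype_card_le_finrank (b := fun q => ⟨b q, hT q⟩)
    (.of_comp (Submodule.subtype _) hb)

variable [Infinite K] [Fintype ι]

theorem mul_prod_le_pow_of_sum_mul_totalDegree_le {N : ℕ} {f : ι → MvPolynomial σ K}
    {p : Fin N → σ → K} (hp : Function.Injective p) (hzero : ∀ j i, eval (p j) (f i) = 0)
    (hJ : ∀ j, Function.Surjective (jacobianAt f (p j))) (B : ι → ℕ) {T : ℕ}
    (hT : ∑ i, B i * (f i).totalDegree + N ≤ T) :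
    N * ∏ i, B i ≤ (T + 1) ^ Fintype.card σ := by
  classical
  obtain ⟨u, hudeg, hu⟩ := exists_totalDegree_le_one_injective_eval hp
  let index : Fin N × (∀ i, Fin (B i)) → Σ _ : Fin N, ι →₀ ℕ := fun q =>
    ⟨q.1, Finsupp.equivFunOnFinite.symm fun i => (q.2 i : ℕ)⟩
  have hindex : Function.Injective index := by
    rintro ⟨k, β⟩ ⟨l, γ⟩ h
    simp only [index, Sigma.mk.injEq, heq_eq_eq, EmbeddingLike.apply_eq_iff_eq, funext_iff,
      Fin.val_inj] at h
    exact Prod.ext h.1 (funext h.2)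
  have hdeg (q) : aeval f (monomial (index q).2 (1 : K)) * u ^ ((index q).1 : ℕ) ∈
      restrictDegree σ K T := by
    refine restrictTotalDegree_le_restrictDegree σ K T <|
      (mem_restrictTotalDegree ..).2 <| (totalDegree_mul _ _).trans <|
        (add_le_add ?_ ?_).trans hT
    · rw [aeval_monomial, map_one, one_mul, Finsupp.prod_fintype _ _ fun _ => pow_zero _]
      refine (totalDegree_finsetProd _ _).trans (Finset.sum_le_sum fun i _ => ?_)
      exact (totalDegree_pow _ _).trans (Nat.mul_le_mul_right _ (q.2 i).2.le)
    · exact (totalDegree_pow _ _).trans ((Nat.mul_le_mul q.1.2.le hudeg).trans (mul_one _).le)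
  simpa using card_le_of_linearIndependent_of_mem_restrictDegree
    ((linearIndependent_aeval_monomial_mul_pow hzero hJ hu).comp index hindex) hdeg

theorem card_nondegenerateZeros_le {N : ℕ} {f : ι → MvPolynomial σ K} {p : Fin N → σ → K}
    (hp : Function.Injective p) (hf : ∀ j, IsNondegenerateZero f (p j)) :
    N ≤ (Fintype.card ι + 1) ^ Fintype.card ι * ∏ i, (f i).totalDegree := by
  classical
  rcases N.eq_zero_or_pos with rfl | hN
  · exact Nat.zero_le _
  set n := Fintype.card ι with hn
  set Q := ∏ i, (f i).totalDegree
  have hQpos : 0 < Q := Finset.prod_pos fun i _ => ((hf ⟨0, hN⟩).totalDegree_ne_zero i).bot_lt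
  set M := (N + 1) * Q
  -- With these exponents all the `f i ^ B i` have the same degree `M`.
  let B : ι → ℕ := fun i => (N + 1) * ∏ j ∈ Finset.univ.erase i, (f j).totalDegree
  have hB (i : ι) : B i * (f i).totalDegree = M := by
    rw [mul_assoc, Finset.prod_erase_mul _ _ (Finset.mem_univ i)]
  have hcount : N * ∏ i, B i ≤ (n * M + N + 1) ^ n := by
    rw [hn, ← (hf ⟨0, hN⟩).card_eq]
    refine mul_prod_le_pow_of_sum_mul_totalDegree_le hp (fun j => (hf j).eval_eq_zero)
      (fun j => (hf j).bijective_jacobianAt.surjective) B ?_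
    simp [hB, (hf ⟨0, hN⟩).card_eq]
  have hM : n * M + N + 1 ≤ (n + 1) * M := by
    linarith [show N + 1 ≤ M from Nat.le_mul_of_pos_right (N + 1) hQpos]
  refine Nat.le_of_mul_le_mul_right ?_ (by positivity : 0 < M ^ n)
  calc N * M ^ n = (N * ∏ i, B i) * Q := by
        rw [mul_assoc, ← Finset.prod_mul_distrib]
        simp [hB, hn]
    _ ≤ ((n + 1) * M) ^ n * Q := by gcongr; exact hcount.trans (by gcongr)
    _ = (n + 1) ^ n * Q * M ^ n := by rw [mul_pow]; ring

theorem encard_nondegenerateZeros_le (f : ι → MvPolynomial σ K) :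
    {p | IsNondegenerateZero f p}.encard ≤
      ↑((Fintype.card ι + 1) ^ Fintype.card ι * ∏ i, (f i).totalDegree) := by
  by_contra! hlt
  obtain ⟨S, hS, hcard⟩ := Set.exists_subset_encard_eq (Order.add_one_le_of_lt hlt)
  have hfin : S.Finite := Set.finite_of_encard_eq_coe (by exact_mod_cast hcard)
  lift S to Finset (σ → K) using hfin
  rw [Set.encard_coe_eq_coe_finsetCard] at hcard
  have hle := card_nondegenerateZeros_le (p := fun j => (S.equivFin.symm j : σ → K))
    (Subtype.val_injective.comp S.equivFin.symm.injective) fun j => hS (S.equivFin.symm j).2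
  norm_cast at hcard
  omega

end Bezout

section Derivatives

variable {σ R : Type*} [CommSemiring R]

theorem totalDegree_pderiv_le (f : MvPolynomial σ R) (s : σ) :
    (pderiv s f).totalDegree ≤ f.totalDegree - 1 := by
  classical
  refine Finset.sup_le fun m hm => ?_
  rw [mem_support_iff, coeff_pderiv] at hm
  have hle := le_totalDegree (mem_support_iff.2 (left_ne_zero_of_mul hm))
  rw [Finsupp.sum_add_index' (fun _ => rfl) (fun _ _ _ => rfl),
    Finsupp.sum_single_index rfl] at hle
  omega

variable [NoZeroDivisors R] [CharZero R]

theorem exists_pderiv_ne_zero {f : MvPolynomial σ R} (hf : f.totalDegree ≠ 0) :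
    ∃ s, pderiv s f ≠ 0 := by
  contrapose! hf
  refine (totalDegree_eq_zero_iff _ f).2 fun m hm s => ?_
  by_contra hms
  have hcoeff := congrArg (coeff (m - Finsupp.single s 1)) (hf s)
  rw [coeff_pderiv, coeff_zero, tsub_add_cancel_of_le (by
    simpa [Finsupp.single_le_iff] using Nat.one_le_iff_ne_zero.2 hms)] at hcoeff
  exact mul_ne_zero (mem_support_iff.1 hm) (Nat.cast_add_one_ne_zero _) hcoeff

theorem exists_finset_differentialAt_ne_zero [Fintype σ] {f : MvPolynomial σ R} (hf : f ≠ 0) :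
    ∃ S : Finset (MvPolynomial σ R), ∀ p, eval p f = 0 →
      ∃ h ∈ S, eval p h = 0 ∧ differentialAt h p ≠ 0 := by
  classical
  induction hn : f.totalDegree using Nat.strong_induction_on generalizing f with
  | _ n ih =>
    subst hn
    by_cases h0 : f.totalDegree = 0
    · refine ⟨∅, fun p hp => (hf ?_).elim⟩
      rw [totalDegree_eq_zero_iff_eq_C.1 h0, eval_C] at hp
      rw [totalDegree_eq_zero_iff_eq_C.1 h0, hp, C_0]
    obtain ⟨s, hs⟩ := exists_pderiv_ne_zero h0
    obtain ⟨S, hS⟩ := ih _ ((totalDegree_pderiv_le f s).trans_lt (by omega)) hs rfl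
    refine ⟨insert f S, fun p hp => ?_⟩
    by_cases hps : eval p (pderiv s f) = 0
    · obtain ⟨h, hh, hzero⟩ := hS p hps
      exact ⟨h, Finset.mem_insert_of_mem hh, hzero⟩
    · refine ⟨f, Finset.mem_insert_self _ _, hp, fun hdf => hps ?_⟩
      rw [← differentialAt_single, hdf, LinearMap.zero_apply]

end Derivatives

section Replacement

variable {ι K : Type*} [Field K]

theorem exists_bijective_pi_update [Finite ι] [DecidableEq ι] {W : Type*} [AddCommGroup W]
    [Module K W] {ℓ : ι → Module.Dual K W} (hℓ : Function.Bijective (LinearMap.pi ℓ))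
    {φ : Module.Dual K W} (hφ : φ ≠ 0) :
    ∃ j, Function.Bijective (LinearMap.pi (Function.update ℓ j φ)) := by
  have := Fintype.ofFinite ι
  let E : W ≃ₗ[K] (ι → K) := LinearEquiv.ofBijective _ hℓ
  have hE (w : W) (i : ι) : E w i = ℓ i w := rfl
  have : Module.Finite K W := Module.Finite.equiv E.symm
  obtain ⟨j, hj⟩ : ∃ j, φ (E.symm (Pi.single j 1)) ≠ 0 := by
    contrapose! hφ
    have hcomp : φ ∘ₗ E.symm.toLinearMap = 0 :=
      LinearMap.pi_ext' fun j => LinearMap.ext_ring (by simpa using hφ j)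
    ext w
    simpa using LinearMap.congr_fun hcomp (E w)
  have hinj : Function.Injective (LinearMap.pi (Function.update ℓ j φ)) := by
    rw [← LinearMap.ker_eq_bot, LinearMap.ker_eq_bot']
    intro w hw
    have hEw : E w = E w j • Pi.single j 1 := by
      ext i
      by_cases hij : i = j
      · subst hij; simp
      · simpa [hij, hE] using congrFun hw i
    have hwj : w = E w j • E.symm (Pi.single j 1) := by
      rw [← map_smul, ← hEw, E.symm_apply_apply]
    have hφw : φ w = 0 := by simpa using congrFun hw j
    rw [hwj, map_smul, smul_eq_mul] at hφw
    rw [hwj, (mul_eq_zero.1 hφw).resolve_right hj, zero_smul]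
  exact ⟨j, hinj, (LinearMap.injective_iff_surjective_of_finrank_eq_finrank E.finrank_eq).1 hinj⟩

variable {σ : Type*} [Fintype σ] [DecidableEq ι]

theorem IsNondegenerateZero.exists_update [Finite ι] {g : ι → MvPolynomial σ K} {p : σ → K}
    (hg : IsNondegenerateZero g p) {h : MvPolynomial σ K} (hp : eval p h = 0)
    (hdh : differentialAt h p ≠ 0) : ∃ j, IsNondegenerateZero (Function.update g j h) p := by
  obtain ⟨j, hj⟩ := exists_bijective_pi_update hg.bijective_jacobianAt hdh
  refine ⟨j, fun i => ?_, by rwa [jacobianAt_update]⟩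
  rcases eq_or_ne i j with rfl | hij
  · rwa [Function.update_self]
  · rw [Function.update_of_ne hij]
    exact hg.eval_eq_zero i

theorem exists_encard_zeros_inter_nondegenerateZeros_le [Fintype ι] [CharZero K]
    {f : MvPolynomial σ K} (hf : f ≠ 0) :
    ∃ C : ℕ, ∀ g : ι → MvPolynomial σ K,
      {p | eval p f = 0 ∧ IsNondegenerateZero g p}.encard ≤
        ↑(C * ∑ j, ∏ i ∈ Finset.univ.erase j, (g i).totalDegree) := by
  obtain ⟨S, hS⟩ := exists_finset_differentialAt_ne_zero hf
  have : Infinite K := CharZero.infinite K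
  set c := (Fintype.card ι + 1) ^ Fintype.card ι
  refine ⟨c * ∑ h ∈ S, h.totalDegree, fun g => ?_⟩
  have hsub : {p | eval p f = 0 ∧ IsNondegenerateZero g p} ⊆
      ⋃ q ∈ S ×ˢ Finset.univ, {p | IsNondegenerateZero (Function.update g q.2 q.1) p} := by
    rintro p ⟨hp, hgp⟩
    obtain ⟨h, hh, hph, hdh⟩ := hS p hp
    obtain ⟨j, hj⟩ := hgp.exists_update hph hdh
    exact Set.mem_biUnion (x := (h, j)) (by simpa using hh) hj
  have hprod (h : MvPolynomial σ K) (j : ι) :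
      ∏ i, (Function.update g j h i).totalDegree =
        h.totalDegree * ∏ i ∈ Finset.univ.erase j, (g i).totalDegree := by
    rw [← Finset.mul_prod_erase _ _ (Finset.mem_univ j), Function.update_self]
    congr! 2 with i hi
    rw [Function.update_of_ne (Finset.ne_of_mem_erase hi)]
  calc {p | eval p f = 0 ∧ IsNondegenerateZero g p}.encard
      ≤ (⋃ q ∈ S ×ˢ Finset.univ, {p | IsNondegenerateZero (Function.update g q.2 q.1) p}).encard :=
        Set.encard_le_encard hsub
    _ ≤ ∑ q ∈ S ×ˢ Finset.univ, {p | IsNondegenerateZero (Function.update g q.2 q.1) p}.encard :=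
        Finset.set_encard_biUnion_le _ _
    _ ≤ ∑ q ∈ S ×ˢ Finset.univ, ↑(c * ∏ i, (Function.update g q.2 q.1 i).totalDegree) :=
        Finset.sum_le_sum fun q _ => encard_nondegenerateZeros_le _
    _ = ↑(c * (∑ h ∈ S, h.totalDegree) * ∑ j, ∏ i ∈ Finset.univ.erase j, (g i).totalDegree) := by
        rw [← Nat.cast_sum]
        simp only [hprod, Finset.sum_product, ← Finset.mul_sum, ← Finset.sum_mul, mul_assoc]

end Replacement

section Hypersurfaces

variable {σ : Type*}

theorem exists_vanishingIdeal_eq_span {K : Type*} [Field K] [IsAlgClosed K] [Finite σ]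
    (F : MvPolynomial σ K) :
    ∃ g : MvPolynomial σ K, g.totalDegree ≤ F.totalDegree ∧
      vanishingIdeal K {x : σ → K | eval x F = 0} = Ideal.span {g} := by
  have hZ : {x : σ → K | eval x F = 0} = zeroLocus K (Ideal.span {F}) := by
    rw [zeroLocus_span]
    ext x
    simp [aeval_eq_eval]
  rw [hZ, vanishingIdeal_zeroLocus_eq_radical]
  rcases eq_or_ne F 0 with rfl | hF
  · exact ⟨0, le_rfl, by simp⟩
  · classical
    let : StrongNormalizationMonoid (MvPolynomial σ K) :=
      UniqueFactorizationMonoid.strongNormalizationMonoid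
    refine ⟨UniqueFactorizationMonoid.radical F,
      totalDegree_le_of_dvd_of_isDomain UniqueFactorizationMonoid.radical_dvd_self hF, ?_⟩
    ext x
    simp only [Ideal.mem_radical_iff, Ideal.mem_span_singleton]
    exact UniqueFactorizationMonoid.exists_dvd_pow_iff_radical_dvd hF

theorem IsAlgebraicSubset.exists_ne_zero_eval_eq_zero {V : Set (σ → ℂ)}
    (hV : IsAlgebraicSubset V) (hV' : V ≠ Set.univ) :
    ∃ f : MvPolynomial σ ℂ, f ≠ 0 ∧ ∀ x ∈ V, eval x f = 0 := by
  obtain ⟨I, rfl⟩ := hV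
  have hI : I ≠ ⊥ := by
    rintro rfl
    exact hV' (by simp)
  obtain ⟨f, hfI, hf⟩ := Submodule.exists_mem_ne_zero_of_ne_bot hI
  exact ⟨f, hf, fun x hx => by simpa [aeval_eq_eval] using hx f hfI⟩

variable {ι : Type*} [Fintype σ] [Fintype ι] {p : σ → ℂ}

theorem tangentSpaceAt_eq_ker_differentialAt {Z : Set (σ → ℂ)} {g : MvPolynomial σ ℂ}
    (hg : vanishingIdeal ℂ Z = Ideal.span {g}) (hgp : eval p g = 0) :
    tangentSpaceAt Z p = LinearMap.ker (differentialAt g p) := by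
  ext v
  simp only [tangentSpaceAt, Submodule.mem_mk, AddSubmonoid.mem_mk, AddSubsemigroup.mem_mk,
    Set.mem_ofPred_eq, ← differentialAt_apply, hg, Ideal.mem_span_singleton, LinearMap.mem_ker]
  refine ⟨fun hv => hv g dvd_rfl, ?_⟩
  rintro hv _ ⟨h, rfl⟩
  simp [differentialAt_mul, hgp, hv]

theorem isNondegenerateZero_of_hypersurfacesTransverseAt
    (hcard : Fintype.card σ = Fintype.card ι) {Z : ι → Set (σ → ℂ)} {g : ι → MvPolynomial σ ℂ}
    (hg : ∀ i, vanishingIdeal ℂ (Z i) = Ideal.span {g i}) (hp : ∀ i, p ∈ Z i)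
    (htr : HypersurfacesTransverseAt Z p) : IsNondegenerateZero g p := by
  have hgp (i : ι) : eval p (g i) = 0 := by
    have hgi : g i ∈ vanishingIdeal ℂ (Z i) := hg i ▸ Ideal.mem_span_singleton_self _
    simpa [aeval_eq_eval] using hgi p (hp i)
  have htangent (i : ι) := tangentSpaceAt_eq_ker_differentialAt (hg i) (hgp i)
  have hker : LinearMap.ker (jacobianAt g p) = ⊥ := by
    rw [jacobianAt, LinearMap.ker_pi, ← iInf_congr htangent, ← Submodule.finrank_eq_zero]
    simpa only [HypersurfacesTransverseAt, hcard, Nat.add_eq_right] using htr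
  have hinj := LinearMap.ker_eq_bot.1 hker
  exact ⟨hgp, hinj,
    (LinearMap.injective_iff_surjective_of_finrank_eq_finrank (by simp [hcard])).1 hinj⟩

theorem exists_encard_inter_transverse_le [DecidableEq ι] (hcard : Fintype.card σ = Fintype.card ι)
    {V : Set (σ → ℂ)} (hV : IsAlgebraicSubset V) (hV' : V ≠ Set.univ) :
    ∃ C : ℕ, ∀ F : ι → MvPolynomial σ ℂ,
      {p ∈ V | (∀ i, eval p (F i) = 0) ∧
        HypersurfacesTransverseAt (fun i => {x | eval x (F i) = 0}) p}.encard ≤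
          ↑(C * ∑ j, ∏ i ∈ Finset.univ.erase j, (F i).totalDegree) := by
  obtain ⟨f, hf, hfV⟩ := hV.exists_ne_zero_eval_eq_zero hV'
  obtain ⟨C, hC⟩ := exists_encard_zeros_inter_nondegenerateZeros_le (ι := ι) hf
  refine ⟨C, fun F => ?_⟩
  choose g hgdeg hg using fun i => exists_vanishingIdeal_eq_span (F i)
  refine (Set.encard_le_encard ?_).trans ((hC g).trans ?_)
  · rintro p ⟨hpV, hpF, htr⟩
    exact ⟨hfV p hpV, isNondegenerateZero_of_hypersurfacesTransverseAt hcard hg hpF htr⟩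
  · gcongr with j _ i _
    exact hgdeg i

end Hypersurfaces

section CriticalOrbits

theorem totalDegree_esymm_le {τ R : Type*} [Fintype τ] [CommSemiring R] (k : ℕ) :
    (esymm τ R k).totalDegree ≤ k := by
  refine (IsHomogeneous.sum _ _ k fun t ht => ?_).totalDegree_le
  simpa [(Finset.mem_powersetCard.1 ht).2] using
    IsHomogeneous.prod t (fun s => X s) (fun _ => 1) fun s _ => isHomogeneous_X R s

variable {d : ℕ}

/-- `c_i`, as a polynomial in the parameters `(c, a)`. -/
noncomputable def critPointPoly (i : Fin (d - 1)) : MvPolynomial (ParamIndex d) ℂ :=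
  if h : (i : ℕ) = 0 then 0 else X (Sum.inl ⟨(i : ℕ) - 1, by omega⟩)

/-- `P_{c,a}(q)`, as a polynomial in the parameters `(c, a)`, for `q` polynomial in `(c, a)`. -/
noncomputable def critPolyComp (q : MvPolynomial (ParamIndex d) ℂ) :
    MvPolynomial (ParamIndex d) ℂ :=
  C (1 / (d : ℂ)) * q ^ d
    + ∑ j ∈ Finset.Icc 2 (d - 1),
        C ((-1 : ℂ) ^ (d - j) / (j : ℂ)) * rename Sum.inl (esymm (Fin (d - 2)) ℂ (d - j)) * q ^ j
    + X (Sum.inr ()) ^ d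

/-- `P_{c,a}^k(c_i)`, as a polynomial in the parameters `(c, a)`. -/
noncomputable def critOrbitPoly (i : Fin (d - 1)) (k : ℕ) : MvPolynomial (ParamIndex d) ℂ :=
  critPolyComp^[k] (critPointPoly i)

/-- The equation `P_{c,a}^m(c_i) - P_{c,a}^n(c_i)` of `Per_i(m, n)`. -/
noncomputable def perPoly (i : Fin (d - 1)) (m n : ℕ) : MvPolynomial (ParamIndex d) ℂ :=
  critOrbitPoly i m - critOrbitPoly i n

theorem eval_critPointPoly (x : ParamSpace d) (i : Fin (d - 1)) :
    eval x (critPointPoly i) = critPoint x i := by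
  unfold critPointPoly critPoint paramC
  split_ifs <;> simp

theorem eval_critPolyComp (x : ParamSpace d) (q : MvPolynomial (ParamIndex d) ℂ) :
    eval x (critPolyComp q) = (critPoly x).eval (eval x q) := by
  simp only [critPolyComp, critPoly, map_add, map_mul, map_sum, map_pow, eval_C, eval_X,
    eval_rename, Polynomial.eval_add, Polynomial.eval_mul, Polynomial.eval_C, Polynomial.eval_pow,
    Polynomial.eval_X, Polynomial.eval_finsetSum, paramA, show x ∘ Sum.inl = paramC x from rfl,
    div_mul_eq_mul_div]

theorem eval_critOrbitPoly (x : ParamSpace d) (i : Fin (d - 1)) (k : ℕ) :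
    eval x (critOrbitPoly i k) = critOrbit x i k := by
  rw [critOrbitPoly, critOrbit, ← eval_critPointPoly]
  have hsemiconj : Function.Semiconj (eval x) critPolyComp fun z => (critPoly x).eval z :=
    eval_critPolyComp x
  exact hsemiconj.iterate_right k _

theorem perLocus_eq_zeros (i : Fin (d - 1)) (m n : ℕ) :
    PerLocus i m n = {x : ParamSpace d | eval x (perPoly i m n) = 0} := by
  ext x
  simp [PerLocus, perPoly, eval_critOrbitPoly, sub_eq_zero]

theorem totalDegree_critPointPoly_le (i : Fin (d - 1)) : (critPointPoly i).totalDegree ≤ 1 := by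
  unfold critPointPoly
  split_ifs <;> simp

/-- `P_{c,a}(z)` has weighted degree `d` in `(c, a, z)`. -/
theorem totalDegree_critPolyComp_le {q : MvPolynomial (ParamIndex d) ℂ} {D : ℕ} (hD : 1 ≤ D)
    (hq : q.totalDegree ≤ D) : (critPolyComp q).totalDegree ≤ d * D := by
  have hpow (j : ℕ) : (q ^ j).totalDegree ≤ j * D :=
    (totalDegree_pow _ _).trans (Nat.mul_le_mul_left _ hq)
  refine (totalDegree_add _ _).trans (max_le ((totalDegree_add _ _).trans (max_le ?_ ?_)) ?_)
  · refine (totalDegree_mul _ _).trans ?_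
    simpa using hpow d
  · refine totalDegree_finsetSum_le fun j hj => ?_
    have hjd : j ≤ d := (Finset.mem_Icc.1 hj).2.trans (Nat.sub_le d 1)
    calc _ ≤ 0 + (d - j) + j * D :=
          (totalDegree_mul _ _).trans <| add_le_add ((totalDegree_mul _ _).trans <|
            add_le_add (totalDegree_C _).le <|
              (totalDegree_rename_le _ _).trans (totalDegree_esymm_le _)) (hpow j)
      _ ≤ (d - j) * D + j * D := by
          rw [zero_add]
          gcongr
          exact Nat.le_mul_of_pos_right _ hD
      _ = d * D := by rw [← add_mul, Nat.sub_add_cancel hjd]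
  · rw [totalDegree_X_pow]
    exact Nat.le_mul_of_pos_right d hD

theorem totalDegree_critOrbitPoly_le (hd : 1 ≤ d) (i : Fin (d - 1)) (k : ℕ) :
    (critOrbitPoly i k).totalDegree ≤ d ^ k := by
  induction k with
  | zero => simpa [critOrbitPoly] using totalDegree_critPointPoly_le i
  | succ k ih =>
    rw [critOrbitPoly, Function.iterate_succ_apply', pow_succ']
    exact totalDegree_critPolyComp_le (Nat.one_le_pow k d hd) ih

theorem totalDegree_perPoly_le (i : Fin (d - 1)) {m n : ℕ} (hnm : n ≤ m) :
    (perPoly i m n).totalDegree ≤ d ^ m := by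
  have hd : 1 ≤ d := by have := i.pos; omega
  exact (totalDegree_sub _ _).trans <| max_le (totalDegree_critOrbitPoly_le hd i m) <|
    (totalDegree_critOrbitPoly_le hd i n).trans (Nat.pow_le_pow_right hd hnm)

end CriticalOrbits

theorem isLittleO_sum_prod_erase_pow {ι α : Type*} [Fintype ι] [DecidableEq ι] {b : ℝ}
    (hb : 1 < b) {m : α → ι → ℕ} {l : Filter α} (hm : ∀ i, Tendsto (fun k => m k i) l atTop) :
    (fun k => ∑ j, ∏ i ∈ Finset.univ.erase j, b ^ m k i) =o[l] fun k => b ^ ∑ i, m k i := by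
  refine Asymptotics.IsLittleO.fun_sum fun j _ => ?_
  have hlarge : (fun _ => (1 : ℝ)) =o[l] fun k => b ^ m k j :=
    (Asymptotics.isLittleO_const_id_atTop (1 : ℝ)).comp_tendsto <|
      (tendsto_pow_atTop_atTop_of_one_lt hb).comp (hm j)
  have hprod (k : α) : b ^ ∑ i, m k i = b ^ m k j * ∏ i ∈ Finset.univ.erase j, b ^ m k i := by
    rw [Finset.mul_prod_erase _ (fun i => b ^ m k i) (Finset.mem_univ j),
      Finset.prod_pow_eq_pow_sum]
  simpa only [one_mul, hprod] using hlarge.mul_isBigO (Asymptotics.isBigO_refl _ l)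

theorem mainTheorem8 (d : ℕ) (hd : 2 ≤ d)
    (m n : ℕ → Fin (d - 1) → ℕ)
    (hmn : ∀ k i, n k i < m k i)
    (hm : ∀ i, Filter.Tendsto (fun k => m k i) Filter.atTop Filter.atTop)
    (V : Set (ParamSpace d)) (hV : IsAlgebraicSubset V) (hV' : V ≠ Set.univ) :
    (∀ k, (V ∩ TPCF (m k) (n k)).Finite) ∧
    Asymptotics.IsLittleO Filter.atTop
      (fun k => ((V ∩ TPCF (m k) (n k)).ncard : ℝ))
      (fun k => (d : ℝ) ^ (∑ i, m k i)) := by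
  have hcard : Fintype.card (ParamIndex d) = Fintype.card (Fin (d - 1)) := by
    simp only [Fintype.card_sum, Fintype.card_fin, Fintype.card_unit]
    omega
  obtain ⟨C, hC⟩ := exists_encard_inter_transverse_le hcard hV hV'
  have hbound (k : ℕ) : (V ∩ TPCF (m k) (n k)).encard ≤
      ↑(C * ∑ j, ∏ i ∈ Finset.univ.erase j, d ^ m k i) := by
    refine (Set.encard_le_encard ?_).trans ((hC fun i => perPoly i (m k i) (n k i)).trans ?_)
    · simp only [← perLocus_eq_zeros]
      rintro p ⟨hpV, hpcf, -, htr⟩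
      refine ⟨hpV, fun i => ?_, htr⟩
      simpa only [perLocus_eq_zeros, Set.mem_ofPred_eq] using Set.mem_iInter.1 hpcf i
    · gcongr with j _ i _
      exact totalDegree_perPoly_le i (hmn k i).le
  refine ⟨fun k => Set.finite_of_encard_le_coe (hbound k),
    Asymptotics.IsBigO.trans_isLittleO (.of_bound C <| .of_forall fun k => ?_)
      (isLittleO_sum_prod_erase_pow (by exact_mod_cast hd) hm)⟩
  rw [Real.norm_of_nonneg (by positivity), Real.norm_of_nonneg (by positivity)]
  exact_mod_cast ENat.toNat_le_of_le_natCast (hbound k)
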